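/- For $n\ge 1$ let $B_{1,n}=\langle t,\sigma_1,\dots,\sigma_{n-1}\rangle$ be the Artin braid group of type B (relations $\sigma_1t\sigma_1t=t\sigma_1t\sigma_1$, $t\sigma_i=\sigma_it$ for $i>1$, and the usual braid relations), and let $\mathrm H_{1,n}(q)=\mathbb C[q^{\pm1}]B_{1,n}/\langle \sigma_i^2-(q-1)\sigma_i-q\rangle$, with canonical map $\pi:B_{1,n}\to \mathrm H_{1,n}(q)$ and $g_i=\pi(\sigma_i)$. Put $t_i=\sigma_i\cdots\sigma_1t\sigma_1\cdots\sigma_i$ and $t_i'=\sigma_i\cdots\sigma_1t\sigma_1^{-1}\cdots\sigma_i^{-1}$. Let $A$ be a commutative $\mathbb C[q^{\pm1}]$-algebra in which $1-q$ is invertible, let $z\in A$ be invertible, let $\lambda=\frac{z+1-q}{qz}$ have an invertible square root $\sqrt\lambda\in A$, and let $s_k\in A$ $(k\in\mathbb Z)$ be arbitrary with $s_0=1$. Let $\mathrm{tr}:\bigcup_n\mathrm H_{1,n}(q)\to A$ be the Markov trace with these parameters, i.e. the unique linear map with $\mathrm{tr}(ab)=\mathrm{tr}(ba)$, $\mathrm{tr}(1)=1$,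 $\mathrm{tr}(ag_n)=z\,\mathrm{tr}(a)$ and $\mathrm{tr}(a\,\pi(t_n')^k)=s_k\,\mathrm{tr}(a)$ for $a\in \mathrm H_{1,n}(q)$. For the closure $\widehat\alpha$ (an oriented link in the solid torus) of $\alpha\in B_{1,n}$ let $$X_{\widehat\alpha}=\Delta^{n-1}\sqrt\lambda^{\,e}\,\mathrm{tr}(\pi(\alpha)),\qquad \Delta=-\frac{1-\lambda q}{\sqrt\lambda(1-q)},$$ where $e$ is the exponent sum of the $\sigma_i$ in $\alpha$ ($t$ counting $0$). Let $m\ge0$, let $k_0,\dots,k_m$ be non-zero integers with sum $k$, and put $\tau=t_0^{k_0}t_1^{k_1}\cdots t_m^{k_m}\in B_{1,m+1}$ (where $t_0=t$) and $\tau_+=t_1^{k_0}t_2^{k_1}\cdots t_{m+1}^{k_m}\in B_{1,m+2}$. Then the system $$X_{\widehat\tau}=X_{\widehat{\tau_+\sigma_1}},\qquad X_{\widehat\tau}=X_{\widehat{\tau_+\sigma_1^{-1}}}$$ is equivalent to the system $$\mathrm{tr}(\tau)=\frac1z\,\sqrt\lambda^{\,e_2-e_1-1}\,\mathrm{tr}(\tau_+\sigma_1),\qquad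 \mathrm{tr}(\tau)=\frac1z\,\sqrt\lambda^{\,e_2-e_1-3}\,\mathrm{tr}(\tau_+\sigma_1^{-1}),$$ where $e_1=\sum_{i=1}^m 2i\,k_i$ and $e_2=1+\sum_{i=1}^{m+1}2i\,k_{i-1}$ (and $\pi$ is suppressed inside $\mathrm{tr}$). -/

import Mathlib

open scoped LaurentPolynomial

noncomputable section

namespace STSkein

/-- Generators of the mixed braid group `B_{1,m+1}`: the loop `t` and `σ₁, …, σ_m`.
The index is zero-based: `sigma i` with `i : Fin m` is the generator `σ_{i+1}`. -/
inductive BraidGen (m : ℕ) : Type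
  | t : BraidGen m
  | sigma (i : Fin m) : BraidGen m

/-- The free-group letter `t`. -/
def letterT (m : ℕ) : FreeGroup (BraidGen m) := FreeGroup.of BraidGen.t

/-- The free-group letter `σ_{i+1}`. -/
def letterS {m : ℕ} (i : Fin m) : FreeGroup (BraidGen m) := FreeGroup.of (BraidGen.sigma i)

/-- The defining relations of the Artin braid group of type B (indices are zero-based). -/
inductive BraidRel (m : ℕ) : FreeGroup (BraidGen m) → FreeGroup (BraidGen m) → Prop
  | four (i : Fin m) (hi : (i : ℕ) = 0) :
      BraidRel m (letterS i * letterT m * letterS i * letterT m)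
        (letterT m * letterS i * letterT m * letterS i)
  | loop_comm (i : Fin m) (hi : 0 < (i : ℕ)) :
      BraidRel m (letterT m * letterS i) (letterS i * letterT m)
  | braid (i j : Fin m) (hij : (j : ℕ) = i + 1) :
      BraidRel m (letterS i * letterS j * letterS i) (letterS j * letterS i * letterS j)
  | far_comm (i j : Fin m) (hij : (i : ℕ) + 1 < j) :
      BraidRel m (letterS i * letterS j) (letterS j * letterS i)

/-- The relators of `B_{1,m+1}`. -/
def braidRelators (m : ℕ) : Set (FreeGroup (BraidGen m)) :=
  {w | ∃ a b, BraidRel m a b ∧ w = a * b⁻¹}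

/-- The mixed braid group `B_{1,m+1}` (Artin group of type B) of mixed braids with one fixed
strand and `m + 1` moving strands. -/
abbrev MixedBraid (m : ℕ) : Type := PresentedGroup (braidRelators m)

/-- The braid `t`. -/
def braidT (m : ℕ) : MixedBraid m := PresentedGroup.of BraidGen.t

/-- The braid `σ_{i+1}`. -/
def braidS {m : ℕ} (i : Fin m) : MixedBraid m := PresentedGroup.of (BraidGen.sigma i)

/-- A map on generators that respects the defining relations gives a homomorphism. -/
def MixedBraid.lift {m : ℕ} {G : Type} [Group G] (f : BraidGen m → G)
    (hf : ∀ a b, BraidRel m a b → FreeGroup.lift f a = FreeGroup.lift f b) :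
    MixedBraid m →* G :=
  PresentedGroup.toGroup (f := f) (by
    rintro w ⟨a, b, hab, rfl⟩
    rw [map_mul, map_inv, hf a b hab, mul_inv_cancel])

theorem braid_relation {m : ℕ} {a b : FreeGroup (BraidGen m)} (h : BraidRel m a b) :
    PresentedGroup.mk (braidRelators m) a = PresentedGroup.mk (braidRelators m) b := by
  rw [← mul_inv_eq_one, ← map_inv, ← map_mul]
  exact PresentedGroup.one_of_mem ⟨a, b, h, rfl⟩

/-- Images of the generators under the inclusion adding one moving strand on the right. -/
def stabGen (m : ℕ) : BraidGen m → MixedBraid (m + 1)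
  | .t => braidT (m + 1)
  | .sigma i => braidS i.castSucc

/-- The inclusion `B_{1,m+1} → B_{1,m+2}`, `t ↦ t`, `σ_i ↦ σ_i`. -/
def stab (m : ℕ) : MixedBraid m →* MixedBraid (m + 1) :=
  MixedBraid.lift (stabGen m) (by
    intro a b h
    cases h with
    | four i hi =>
      simpa [letterS, letterT, stabGen, braidS, braidT, PresentedGroup.of] using
        braid_relation (BraidRel.four (m := m + 1) i.castSucc (by simpa using hi))
    | loop_comm i hi =>
      simpa [letterS, letterT, stabGen, braidS, braidT, PresentedGroup.of] using
        braid_relation (BraidRel.loop_comm (m := m + 1) i.castSucc (by simpa using hi))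
    | braid i j hij =>
      simpa [letterS, letterT, stabGen, braidS, braidT, PresentedGroup.of] using
        braid_relation (BraidRel.braid (m := m + 1) i.castSucc j.castSucc (by simpa using hij))
    | far_comm i j hij =>
      simpa [letterS, letterT, stabGen, braidS, braidT, PresentedGroup.of] using
        braid_relation
          (BraidRel.far_comm (m := m + 1) i.castSucc j.castSucc (by simpa using hij)))

/-- Exponents of the generators: `t` counts `0` and each `σ_i` counts `1`. -/
def expGen (m : ℕ) : BraidGen m → Multiplicative ℤ
  | .t => 1
  | .sigma _ => Multiplicative.ofAdd 1

/-- The exponent-sum homomorphism of the `σ_i`, written multiplicatively. -/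
def expHom (m : ℕ) : MixedBraid m →* Multiplicative ℤ :=
  MixedBraid.lift (expGen m) (by
    intro a b h
    cases h <;> simp [letterS, letterT, expGen])

/-- The exponent sum of the `σ_i` in a mixed braid (the loop `t` does not count). -/
def expSum {m : ℕ} (α : MixedBraid m) : ℤ := Multiplicative.toAdd (expHom m α)

/-- The looping braid `t_i = σ_i ⋯ σ₁ t σ₁ ⋯ σ_i`, for `0 ≤ i ≤ m`. -/
def loop (m : ℕ) : (i : ℕ) → i ≤ m → MixedBraid m
  | 0, _ => braidT m
  | i + 1, h => braidS ⟨i, h⟩ * loop m i (Nat.le_of_succ_le h) * braidS ⟨i, h⟩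

/-- The looping braid `t'_i = σ_i ⋯ σ₁ t σ₁⁻¹ ⋯ σ_i⁻¹`, for `0 ≤ i ≤ m`. -/
def loop' (m : ℕ) : (i : ℕ) → i ≤ m → MixedBraid m
  | 0, _ => braidT m
  | i + 1, h => braidS ⟨i, h⟩ * loop' m i (Nat.le_of_succ_le h) * (braidS ⟨i, h⟩)⁻¹

/-- The monomial `τ_{j,j+m}^{k_{0,m}} = t_j^{k_0} t_{j+1}^{k_1} ⋯ t_{j+m}^{k_m}`
in `B_{1,N+1}`, where `j + m ≤ N`. -/
def tau (N j m : ℕ) (h : j + m ≤ N) (k : Fin (m + 1) → ℤ) : MixedBraid N :=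
  (List.ofFn fun i : Fin (m + 1) => loop N (j + i) (by omega) ^ k i).prod

/-- The variable `q` of `ℂ[q^{±1}]`. -/
def qVar : ℂ[T;T⁻¹] := LaurentPolynomial.T 1

/-- The Hecke relations `σ_i² = (q - 1) σ_i + q` in the group algebra `ℂ[q^{±1}] B_{1,m+1}`. -/
inductive HeckeRel (m : ℕ) :
    MonoidAlgebra ℂ[T;T⁻¹] (MixedBraid m) → MonoidAlgebra ℂ[T;T⁻¹] (MixedBraid m) → Prop
  | quad (i : Fin m) :
      HeckeRel m (MonoidAlgebra.of ℂ[T;T⁻¹] (MixedBraid m) (braidS i) ^ 2)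
        ((qVar - 1) • MonoidAlgebra.of ℂ[T;T⁻¹] (MixedBraid m) (braidS i) + qVar • 1)

/-- The generalized Iwahori–Hecke algebra of type B, `H_{1,m+1}(q)`. -/
abbrev Hecke (m : ℕ) : Type := RingQuot (HeckeRel m)

/-- The canonical map `π : B_{1,m+1} → H_{1,m+1}(q)`. -/
def proj (m : ℕ) : MixedBraid m →* Hecke m :=
  (RingQuot.mkAlgHom ℂ[T;T⁻¹] (HeckeRel m) :
      MonoidAlgebra ℂ[T;T⁻¹] (MixedBraid m) →* Hecke m).comp
    (MonoidAlgebra.of ℂ[T;T⁻¹] (MixedBraid m))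

theorem proj_quad {m : ℕ} (i : Fin m) :
    proj m (braidS i) ^ 2 = (qVar - 1) • proj m (braidS i) + qVar • 1 := by
  have h := RingQuot.mkAlgHom_rel ℂ[T;T⁻¹] (HeckeRel.quad i)
  rw [map_pow, map_add, map_smul, map_smul, map_one] at h
  exact h

theorem stab_braidS {m : ℕ} (i : Fin m) : stab m (braidS i) = braidS i.castSucc := by
  simp [stab, MixedBraid.lift, braidS, stabGen]

/-- The natural map `H_{1,m+1}(q) → H_{1,m+2}(q)` induced by the inclusion of braid groups. -/
def heckeStab (m : ℕ) : Hecke m →ₐ[ℂ[T;T⁻¹]] Hecke (m + 1) :=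
  RingQuot.liftAlgHom ℂ[T;T⁻¹]
    ⟨MonoidAlgebra.lift ℂ[T;T⁻¹] (Hecke (m + 1)) (MixedBraid m) ((proj (m + 1)).comp (stab m)), by
      rintro _ _ ⟨i⟩
      rw [map_pow, map_add, map_smul, map_smul, map_one, MonoidAlgebra.lift_of]
      rw [MonoidHom.comp_apply, stab_braidS]
      exact proj_quad i.castSucc⟩

theorem heckeStab_proj {m : ℕ} (α : MixedBraid m) :
    heckeStab m (proj m α) = proj (m + 1) (stab m α) := by
  simp [heckeStab, proj]

/-- The image of `q` in a commutative `ℂ[q^{±1}]`-algebra, as a unit. -/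
def qUnit (A : Type*) [CommRing A] [Algebra ℂ[T;T⁻¹] A] : Aˣ :=
  Units.map (algebraMap ℂ[T;T⁻¹] A).toMonoidHom
    ⟨LaurentPolynomial.T 1, LaurentPolynomial.T (-1),
      by rw [← LaurentPolynomial.T_add]; simp, by rw [← LaurentPolynomial.T_add]; simp⟩

/-- The parameters of the trace and of the invariant, in a commutative `ℂ[q^{±1}]`-algebra `A`:
an invertible `z`, an invertible square root of `λ = (z + 1 - q) / (q z)`, and the values
`s_k`, `k ∈ ℤ`, with `s₀ = 1`; the element `1 - q`, a denominator of `Δ`, is invertible. -/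
structure SkeinParams (A : Type*) [CommRing A] [Algebra ℂ[T;T⁻¹] A] where
  z : Aˣ
  sqrtLam : Aˣ
  sqrtLam_sq : (sqrtLam : A) ^ 2 = ((z : A) + 1 - qUnit A) /ₚ (qUnit A * z)
  oneSubQ : Aˣ
  oneSubQ_eq : (oneSubQ : A) = 1 - qUnit A
  s : ℤ → A
  s_zero : s 0 = 1

variable {A : Type*} [CommRing A] [Algebra ℂ[T;T⁻¹] A]

/-- `λ = (z + 1 - q) / (q z)`. -/
def SkeinParams.lam (D : SkeinParams A) : A := ((D.z : A) + 1 - qUnit A) /ₚ (qUnit A * D.z)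

/-- `Δ = -(1 - λ q) / (√λ (1 - q))`. -/
def SkeinParams.delta (D : SkeinParams A) : A :=
  -((1 - D.lam * qUnit A) /ₚ (D.sqrtLam * D.oneSubQ))

/-- The rules of a Markov trace with parameters `z` and `s_k` on `⋃ H_{1,n}(q)`: a compatible
family of linear maps on the algebras `H_{1,m+1}(q)` with `tr(ab) = tr(ba)`, `tr(1) = 1`,
`tr(a g_n) = z tr(a)` and `tr(a (t'_n)^k) = s_k tr(a)` for `a ∈ H_{1,n}(q)`, where `n = m + 1`. -/
structure IsMarkovTrace (D : SkeinParams A) (T : (m : ℕ) → Hecke m →ₗ[ℂ[T;T⁻¹]] A) : Prop where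
  compat (m : ℕ) (a : Hecke m) : T (m + 1) (heckeStab m a) = T m a
  comm (m : ℕ) (a b : Hecke m) : T m (a * b) = T m (b * a)
  one (m : ℕ) : T m 1 = 1
  markov (m : ℕ) (a : Hecke m) :
    T (m + 1) (heckeStab m a * proj (m + 1) (braidS (Fin.last m))) = D.z * T m a
  looping (m : ℕ) (a : Hecke m) (k : ℤ) :
    T (m + 1) (heckeStab m a * proj (m + 1) (loop' (m + 1) (m + 1) le_rfl ^ k)) = D.s k * T m a

open Classical in
/-- The Markov trace `tr` with parameters `z`, `s_k`: the family of linear maps determined by the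
Markov trace rules. Such a family exists and is unique for every choice of `z` and of the `s_k`
with `s₀ = 1` (Lambropoulou); the value `0` of the other branch is never taken. -/
def markovTrace (D : SkeinParams A) : (m : ℕ) → Hecke m →ₗ[ℂ[T;T⁻¹]] A :=
  if h : ∃ T : (m : ℕ) → Hecke m →ₗ[ℂ[T;T⁻¹]] A, IsMarkovTrace D T then h.choose else 0

/-- Mixed braids on any positive number of moving strands. -/
abbrev AnyBraid : Type := Σ m : ℕ, MixedBraid m

/-- The moves on mixed braids that correspond to isotopy of the closures in the solid torus:
conjugation (loop conjugation is the case `β = t^{±1}`) and stabilization. -/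
inductive MarkovMove : AnyBraid → AnyBraid → Prop
  | conj (m : ℕ) (α β : MixedBraid m) : MarkovMove ⟨m, α⟩ ⟨m, β⁻¹ * α * β⟩
  | stab_pos (m : ℕ) (α : MixedBraid m) :
      MarkovMove ⟨m, α⟩ ⟨m + 1, stab m α * braidS (Fin.last m)⟩
  | stab_neg (m : ℕ) (α : MixedBraid m) :
      MarkovMove ⟨m, α⟩ ⟨m + 1, stab m α * (braidS (Fin.last m))⁻¹⟩

/-- (Non-empty) oriented links in the solid torus, as mixed braids up to the equivalence
relation generated by conjugation and stabilization. -/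
def STLink : Type := Quot MarkovMove

/-- The closure `α̂` of a mixed braid. -/
def closure {m : ℕ} (α : MixedBraid m) : STLink := Quot.mk _ ⟨m, α⟩

/-- `Δ^{n-1} (√λ)^e tr(π(α))` for a mixed braid `α` with `n` moving strands. -/
def braidX (D : SkeinParams A) (α : AnyBraid) : A :=
  D.delta ^ α.1 * ((D.sqrtLam ^ expSum α.2 : Aˣ) : A) * markovTrace D α.1 (proj α.1 α.2)

theorem markovTrace_comm (D : SkeinParams A) (m : ℕ) (a b : Hecke m) :
    markovTrace D m (a * b) = markovTrace D m (b * a) := by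
  unfold markovTrace
  split_ifs with h
  · exact h.choose_spec.comm m a b
  · simp

theorem markovTrace_compat (D : SkeinParams A) (m : ℕ) (a : Hecke m) :
    markovTrace D (m + 1) (heckeStab m a) = markovTrace D m a := by
  unfold markovTrace
  split_ifs with h
  · exact h.choose_spec.compat m a
  · simp

theorem markovTrace_markov (D : SkeinParams A) (m : ℕ) (a : Hecke m) :
    markovTrace D (m + 1) (heckeStab m a * proj (m + 1) (braidS (Fin.last m))) =
      D.z * markovTrace D m a := by
  unfold markovTrace
  split_ifs with h
  · exact h.choose_spec.markov m a
  · simp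

theorem expSum_mul {m : ℕ} (α β : MixedBraid m) : expSum (α * β) = expSum α + expSum β := by
  simp [expSum]

theorem expSum_inv {m : ℕ} (α : MixedBraid m) : expSum α⁻¹ = -expSum α := by
  simp [expSum]

theorem expSum_braidS {m : ℕ} (i : Fin m) : expSum (braidS i) = 1 := by
  simp [expSum, expHom, MixedBraid.lift, braidS, expGen]

theorem expHom_stab {m : ℕ} : (expHom (m + 1)).comp (stab m) = expHom m := by
  apply PresentedGroup.ext
  intro x
  cases x <;> simp [expHom, stab, MixedBraid.lift, stabGen, braidS, braidT, expGen]

theorem expSum_stab {m : ℕ} (α : MixedBraid m) : expSum (stab m α) = expSum α :=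
  congrArg Multiplicative.toAdd (DFunLike.congr_fun expHom_stab α)

theorem SkeinParams.qz_lam (D : SkeinParams A) :
    (qUnit A : A) * D.z * D.lam = D.z + 1 - qUnit A := by
  rw [SkeinParams.lam, mul_comm, ← Units.val_mul, divp_mul_cancel]

theorem SkeinParams.lam_eq (D : SkeinParams A) : D.lam = (D.sqrtLam : A) ^ 2 :=
  D.sqrtLam_sq.symm

/-- `Δ √λ z = 1`. -/
theorem SkeinParams.delta_mul (D : SkeinParams A) :
    D.delta * ((D.sqrtLam : A) * D.z) = 1 := by
  have h1 : (D.z : A) * (1 - D.lam * qUnit A) = -(D.oneSubQ : A) := by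
    rw [D.oneSubQ_eq]
    linear_combination -D.qz_lam
  have h2 : (D.sqrtLam : A) * ((D.sqrtLam⁻¹ : Aˣ) : A) = 1 := Units.mul_inv _
  have h3 : (D.oneSubQ : A) * ((D.oneSubQ⁻¹ : Aˣ) : A) = 1 := Units.mul_inv _
  rw [SkeinParams.delta, divp, mul_inv, Units.val_mul]
  linear_combination (-((D.sqrtLam : A) * ((D.sqrtLam⁻¹ : Aˣ) : A)
    * ((D.oneSubQ⁻¹ : Aˣ) : A))) * h1 + h2 + ((D.sqrtLam : A) * ((D.sqrtLam⁻¹ : Aˣ) : A)) * h3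

theorem qVar_smul (x : A) : qVar • x = (qUnit A : A) * x := by
  rw [Algebra.smul_def]
  rfl

theorem proj_inv {m : ℕ} (i : Fin m) :
    proj m (braidS i) = (qVar - 1) • 1 + qVar • proj m (braidS i)⁻¹ := by
  have h := congrArg (fun x => x * proj m (braidS i)⁻¹) (proj_quad i)
  have h1 : proj m (braidS i) * proj m (braidS i)⁻¹ = 1 := by
    rw [← map_mul, mul_inv_cancel, map_one]
  simp only [pow_two, mul_assoc, add_mul, smul_mul_assoc, h1, mul_one, one_mul] at h
  exact h

/-- The inverse Markov rule `tr(a g_n⁻¹) = λ z tr(a)`. -/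
theorem markovTrace_markov_inv (D : SkeinParams A) (m : ℕ) (a : Hecke m) :
    markovTrace D (m + 1) (heckeStab m a * proj (m + 1) (braidS (Fin.last m))⁻¹) =
      D.lam * D.z * markovTrace D m a := by
  have h := markovTrace_markov D m a
  rw [proj_inv, mul_add, mul_smul_comm, mul_smul_comm, mul_one, map_add, map_smul, map_smul,
    markovTrace_compat, sub_smul, one_smul, qVar_smul, qVar_smul] at h
  apply (qUnit A).isUnit.mul_left_cancel
  linear_combination h - markovTrace D m a * D.qz_lam

theorem braidX_move (D : SkeinParams A) {α β : AnyBraid} (h : MarkovMove α β) :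
    braidX D α = braidX D β := by
  have hd := D.delta_mul
  cases h with
  | conj m α β =>
    have h1 : markovTrace D m (proj m (β⁻¹ * α * β)) = markovTrace D m (proj m α) := by
      rw [map_mul, markovTrace_comm, ← map_mul, ← mul_assoc, mul_inv_cancel, one_mul]
    have h2 : expSum (β⁻¹ * α * β) = expSum α := by
      rw [expSum_mul, expSum_mul, expSum_inv]; ring
    simp only [braidX, h1, h2]
  | stab_pos m α =>
    simp only [braidX, expSum_mul, expSum_stab, expSum_braidS, map_mul, ← heckeStab_proj,
      markovTrace_markov, zpow_add, zpow_one, Units.val_mul, pow_succ]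
    linear_combination (-(D.delta ^ m * ((D.sqrtLam ^ expSum α : Aˣ) : A)
      * markovTrace D m (proj m α))) * hd
  | stab_neg m α =>
    have hr : (D.sqrtLam : A) * ((D.sqrtLam⁻¹ : Aˣ) : A) = 1 := Units.mul_inv _
    simp only [braidX, expSum_mul, expSum_inv, expSum_stab, expSum_braidS]
    rw [map_mul, ← heckeStab_proj, markovTrace_markov_inv, D.lam_eq, zpow_add, zpow_neg_one,
      Units.val_mul, pow_succ]
    linear_combination (-(D.delta ^ m * ((D.sqrtLam ^ expSum α : Aˣ) : A)
      * markovTrace D m (proj m α))) * hd - (D.delta ^ m * D.delta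
      * ((D.sqrtLam ^ expSum α : Aˣ) : A) * D.sqrtLam * D.z * markovTrace D m (proj m α)) * hr

/-- The invariant `X` of oriented links in the solid torus,
`X_{α̂} = Δ^{n-1} (√λ)^e tr(π(α))`. -/
def X (D : SkeinParams A) : STLink → A :=
  Quot.lift (braidX D) fun _ _ h => braidX_move D h

end STSkein

end

open STSkein

namespace STSkein

/-! The two systems match equation by equation, and no trace has to be evaluated. The choice of `λ`
gives `Δ √λ z = 1`, so `Δ` is the unit `(√λ z)⁻¹`. If `β` has one moving strand more than `α`,
dividing `X_α̂ = X_β̂` by the unit `Δ^m √λ^{e(α)}` leaves `tr(α) = Δ √λ^{e(β) - e(α)} tr(β) = z⁻¹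
√λ^{e(β) - e(α) - 1} tr(β)`; this is `X_closure_eq_iff`. What remains is counting exponents with
`expSum_tau`: `e(τ) = e₁` and `e(τ₊) = e₂ - 1`, so `τ₊σ₁` and `τ₊σ₁⁻¹` have exponents `e₂` and `e₂ -
2`. -/

theorem expSum_zpow {m : ℕ} (α : MixedBraid m) (n : ℤ) : expSum (α ^ n) = n * expSum α := by
  simp [expSum, toAdd_zpow]

theorem expSum_braidT (m : ℕ) : expSum (braidT m) = 0 := by
  simp [expSum, expHom, MixedBraid.lift, braidT, expGen]

/-- Each step of the recursion for `loop` puts one more `σ` on either side, and the central `t`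
counts `0`. -/
theorem expSum_loop (m i : ℕ) (h : i ≤ m) : expSum (loop m i h) = 2 * i := by
  induction i with
  | zero => simp [loop, expSum_braidT]
  | succ i ih =>
    rw [loop, expSum_mul, expSum_mul, expSum_braidS, ih]
    push_cast
    ring

theorem expSum_prod_ofFn {N n : ℕ} (f : Fin n → MixedBraid N) :
    expSum (List.ofFn f).prod = ∑ i, expSum (f i) := by
  rw [expSum, map_list_prod, List.map_ofFn, List.prod_ofFn, toAdd_prod]
  rfl

/-- The shift `j` covers both monomials at once: `j = 0` gives `τ` and `j = 1` gives `τ₊`. -/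
theorem expSum_tau (N j m : ℕ) (h : j + m ≤ N) (k : Fin (m + 1) → ℤ) :
    expSum (tau N j m h k) = ∑ i : Fin (m + 1), 2 * ((j : ℤ) + i) * k i := by
  rw [tau, expSum_prod_ofFn]
  refine Finset.sum_congr rfl fun i _ => ?_
  rw [expSum_zpow, expSum_loop]
  push_cast
  ring

section

variable {A : Type*} [CommRing A] [Algebra ℂ[T;T⁻¹] A]

/-- This makes `Δ` cancellable, although `1 - λq` is not assumed invertible. -/
theorem SkeinParams.delta_eq (D : SkeinParams A) :
    D.delta = (((D.sqrtLam * D.z)⁻¹ : Aˣ) : A) := by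
  exact Units.eq_inv_of_mul_eq_one_right D.delta_mul

/-- Comparing `X` on a braid and on one with an additional moving strand amounts to comparing
their traces, up to a unit. -/
theorem X_closure_eq_iff (D : SkeinParams A) {m : ℕ} (α : MixedBraid m)
    (β : MixedBraid (m + 1)) :
    X D (closure α) = X D (closure β) ↔
      markovTrace D m (proj m α) =
        ((D.z⁻¹ * D.sqrtLam ^ (expSum β - expSum α - 1) : Aˣ) : A) *
          markovTrace D (m + 1) (proj (m + 1) β) := by
  change D.delta ^ m * _ * _ = D.delta ^ (m + 1) * _ * _ ↔ _
  -- The comparison of coefficients takes place in the group `Aˣ`, where negative exponents are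
  -- harmless; the factor for `α` is split off from the factor for `β`.
  have hu : (D.sqrtLam * D.z)⁻¹ ^ (m + 1) * D.sqrtLam ^ expSum β =
      ((D.sqrtLam * D.z)⁻¹ ^ m * D.sqrtLam ^ expSum α) *
        (D.z⁻¹ * D.sqrtLam ^ (expSum β - expSum α - 1)) := by
    have hs : D.sqrtLam ^ expSum β =
        D.sqrtLam ^ expSum α * D.sqrtLam ^ (expSum β - expSum α - 1) * D.sqrtLam := by
      rw [← zpow_add, ← zpow_add_one]
      congr 1
      ring
    -- Inserting `√λ⁻¹ √λ` on the right gives both sides the same factors up to order.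
    rw [hs, pow_succ, ← mul_one (_ * (D.z⁻¹ * _)), ← inv_mul_cancel D.sqrtLam,
      mul_inv D.sqrtLam D.z]
    ac_rfl
  rw [D.delta_eq, ← Units.val_pow_eq_pow_val, ← Units.val_pow_eq_pow_val, ← Units.val_mul,
    ← Units.val_mul, hu, Units.val_mul _ (D.z⁻¹ * _), mul_assoc]
  -- Both sides now carry the common unit `Δ^m √λ^{e(α)}`, which cancels.
  exact (Units.isUnit _).mul_right_inj

end

end STSkein

theorem mainTheorem7 {A : Type*} [CommRing A] [Algebra ℂ[T;T⁻¹] A] (D : SkeinParams A)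
    (m : ℕ) (k : Fin (m + 1) → ℤ) (hk : ∀ i, k i ≠ 0)
    (level : ℤ) (hlevel : ∑ i, k i = level)
    (e₁ e₂ : ℤ) (he₁ : e₁ = ∑ i : Fin (m + 1), 2 * (i : ℤ) * k i)
    (he₂ : e₂ = ∑ i : Fin (m + 1), 2 * ((i : ℤ) + 1) * k i + 1)
    (τ : MixedBraid m) (hτ : τ = tau m 0 m (Nat.zero_add m).le k)
    (τp : MixedBraid (m + 1)) (hτp : τp = tau (m + 1) 1 m (Nat.add_comm 1 m).le k) :
    (X D (closure τ) = X D (closure (τp * braidS 0)) ∧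
      X D (closure τ) = X D (closure (τp * (braidS 0)⁻¹))) ↔
    (markovTrace D m (proj m τ) =
        ((D.z⁻¹ * D.sqrtLam ^ (e₂ - e₁ - 1) : Aˣ) : A) *
          markovTrace D (m + 1) (proj (m + 1) (τp * braidS 0)) ∧
      markovTrace D m (proj m τ) =
        ((D.z⁻¹ * D.sqrtLam ^ (e₂ - e₁ - 3) : Aˣ) : A) *
          markovTrace D (m + 1) (proj (m + 1) (τp * (braidS 0)⁻¹))) := by
  have h₁ : expSum τ = e₁ := by
    rw [hτ, he₁, expSum_tau]
    simp
  -- The summand `1` in `e₂` belongs to the extra `σ₁`, not to `τ₊`.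
  have h₂ : expSum τp = e₂ - 1 := by
    rw [hτp, he₂, expSum_tau, add_sub_cancel_right]
    exact Finset.sum_congr rfl fun i _ => by push_cast; ring
  have hpos : expSum (τp * braidS 0) - expSum τ - 1 = e₂ - e₁ - 1 := by
    rw [expSum_mul, expSum_braidS, h₁, h₂]
    ring
  -- Replacing `σ₁` by `σ₁⁻¹` lowers the exponent sum by `2`, hence `3` in place of `1`.
  have hneg : expSum (τp * (braidS 0)⁻¹) - expSum τ - 1 = e₂ - e₁ - 3 := by
    rw [expSum_mul, expSum_inv, expSum_braidS, h₁, h₂]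
    ring
  rw [X_closure_eq_iff, X_closure_eq_iff, hpos, hneg]
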